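/- Let $n\ge 2$, let $m\in\{1,\dots,n-1\}$ be relatively prime to $n$, and put $q=e^{2\pi i m/n}$. Let $u,v$ be unitary $n\times n$ matrices which generate the algebra $M_n$ of complex $n\times n$ matrices and satisfy $vu=quv$, and let $x,y$ be Hermitian matrices with $u=e^{\frac{2\pi i}{n}x}$ and $v=e^{\frac{2\pi i}{n}y}$. For $a\in M_n$ put $\triangle a=[y,[y,a]]+[x,[x,a]]$. Let $P\subset M_n$ be the set of positive definite (Hermitian) matrices, and for $a\in P$ let $\log a$ be obtained by diagonalizing $a$ and applying the real logarithm to its eigenvalues. Let $t_0\in\mathbb{R}$ and $c_{t_0}\in P$, and let $J$ be either $[t_0,\infty)$ or $[t_0,t_1]$ for some $t_1\ge t_0$. Then the noncommutative Ricci flow $$\frac{d}{dt}c(t)=-\triangle\log c(t)$$ has a unique $C^1$ solution $c:J\to P$ with $c(t_0)=c_{t_0}$ (derivatives at endpoints of $J$ are one-sided; for $J=\{t_0\}$ the differential equation imposes no condition). Moreover, any such solution is analytic: for each $t_2\in J$ there is an $\varepsilon>0$ such that, for all $t\in J\cap(t_2-\varepsilon,t_2+\varepsilon)$, each entry of the matrix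 $c(t)$ is the sum of a convergent power series in $t-t_2$ with complex coefficients not depending on $t$. -/

import Mathlib

open scoped Matrix ComplexOrder Matrix.Norms.L2Operator

noncomputable section

/-- The matrix geometry of the fuzzy torus: `u` and `v` are unitary `n × n` matrices which
generate the algebra `M_n` and satisfy `v u = q u v` with `q = exp (2 π i m / n)`, where
`m ∈ {1, …, n - 1}` is coprime to `n`; and `x`, `y` are Hermitian matrices with
`u = exp (2 π i x / n)` and `v = exp (2 π i y / n)`. -/
structure IsFuzzyTorus (n m : ℕ) (u v x y : Matrix (Fin n) (Fin n) ℂ) : Prop where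
  one_le : 1 ≤ m
  lt : m < n
  coprime : Nat.Coprime m n
  u_unitary : u ∈ Matrix.unitaryGroup (Fin n) ℂ
  v_unitary : v ∈ Matrix.unitaryGroup (Fin n) ℂ
  generate : Algebra.adjoin ℂ {u, v} = ⊤
  comm_rel : v * u = Complex.exp (2 * Real.pi * Complex.I * m / n) • (u * v)
  x_herm : x.IsHermitian
  y_herm : y.IsHermitian
  u_eq : u = NormedSpace.exp ((2 * Real.pi * Complex.I / n : ℂ) • x)
  v_eq : v = NormedSpace.exp ((2 * Real.pi * Complex.I / n : ℂ) • y)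

/-- The derivation `δ₁ = [y, ·]` (commutator). -/
def deltaOne {n : ℕ} (y a : Matrix (Fin n) (Fin n) ℂ) : Matrix (Fin n) (Fin n) ℂ :=
  y * a - a * y

/-- The derivation `δ₂ = -[x, ·]` (commutator). -/
def deltaTwo {n : ℕ} (x a : Matrix (Fin n) (Fin n) ℂ) : Matrix (Fin n) (Fin n) ℂ :=
  -(x * a - a * x)

/-- The noncommutative Laplacian `△ = δ₁² + δ₂²`. -/
def ncLaplacian {n : ℕ} (x y a : Matrix (Fin n) (Fin n) ℂ) : Matrix (Fin n) (Fin n) ℂ :=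
  deltaOne y (deltaOne y a) + deltaTwo x (deltaTwo x a)

/-- `c` is a `C¹` solution of the noncommutative Ricci flow `c' = -△ log c` on the set `J`
of times (an interval; at its endpoints in `J` the derivative is one-sided), with values in
the positive definite matrices. Here `CFC.log` is the logarithm of a Hermitian matrix given by
the functional calculus, that is, the real logarithm applied to the eigenvalues. -/
structure IsRicciFlowOn {n : ℕ} (x y : Matrix (Fin n) (Fin n) ℂ) (J : Set ℝ)
    (c : ℝ → Matrix (Fin n) (Fin n) ℂ) : Prop where
  posDef : ∀ t ∈ J, (c t).PosDef
  contDiffOn : ContDiffOn ℝ 1 c J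
  hasDerivWithinAt : ∀ t ∈ J, HasDerivWithinAt c (-ncLaplacian x y (CFC.log (c t))) J t

/-- At each time `t₂ ∈ J`, all entries of `c t` are sums of convergent power series in `t - t₂`
for all `t ∈ J` within some distance `ε > 0` of `t₂`. -/
def EntriesAnalyticOn {n : ℕ} (J : Set ℝ) (c : ℝ → Matrix (Fin n) (Fin n) ℂ) : Prop :=
  ∀ t₂ ∈ J, ∃ ε > 0, ∀ i j, ∃ b : ℕ → ℂ, ∀ t ∈ J ∩ Set.Ioo (t₂ - ε) (t₂ + ε),
    HasSum (fun k => b k * ((t : ℂ) - t₂) ^ k) (c t i j)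

end

/-! The flow stays in a region where `log` is a convergent power series. Let R be the trace of the
initial matrix and S the trace of its inverse. The Laplacian has trace zero, so tr c is constant.
The derivative of tr c⁻¹ is tr(c⁻² △ log c); in an eigenbasis of c this is a sum of terms |w i j|²
(λᵢ⁻² - λⱼ⁻²)(log λᵢ - log λⱼ) ≤ 0, with w running over x and y. So all eigenvalues stay in [S⁻¹,
R], that is, ‖c - R‖ ≤ R - S⁻¹ < R (`norm_ricciFlow_sub_le`).

On the ball of radius R about R • 1 the Mercator series extends -△ log holomorphically to
non-Hermitian matrices (`ricciField`), with a Lipschitz constant on each smaller ball. Picard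
iteration in complex time gives local solutions on discs of uniform radius, and the a priori bound
lets them be continued forever (`exists_hasDerivWithinAt_Ici_of_apriori`). The extended field
commutes with `star`, so Hermitian initial data stay Hermitian. Every Ricci flow solves the extended
equation, so uniqueness is the Lipschitz one, and near each time the flow is the restriction of a
holomorphic solution to real times, hence analytic. -/

section

open Set Metric Filter Topology NNReal

/-! ### Holomorphic differential equations: local and global existence, uniqueness. -/

section ODE

theorem exists_pos_mul_le_half_and_mul_le (K B : ℝ≥0) {d : ℝ} (hd : 0 < d) :
    ∃ ρ : ℝ, 0 < ρ ∧ K * ρ ≤ 1 / 2 ∧ B * ρ ≤ d := by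
  -- The added 1 keeps the denominators positive when `K` or `B` is 0.
  refine ⟨min (1 / (2 * (K + 1))) (d / (B + 1)), by positivity, ?_, ?_⟩
  · refine (mul_le_mul_of_nonneg_left (min_le_left _ _) K.coe_nonneg).trans ?_
    rw [mul_one_div, div_le_iff₀ (by positivity)]
    linarith [K.coe_nonneg]
  · refine (mul_le_mul_of_nonneg_left (min_le_right _ _) B.coe_nonneg).trans ?_
    rw [← mul_div_assoc, div_le_iff₀ (by positivity)]
    nlinarith [B.coe_nonneg]

/-- Cauchy's theorem: an autonomous holomorphic differential equation has a local holomorphic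
solution, on a disc whose radius depends only on a bound and a Lipschitz constant of the
vector field. Holomorphy of the field is only required along holomorphic curves. -/
theorem exists_holomorphic_hasDerivAt {E : Type*} [NormedAddCommGroup E] [NormedSpace ℂ E]
    [CompleteSpace E] {F : E → E} {p : E} {r ρ : ℝ} {K B : ℝ≥0} (hr : 0 ≤ r)
    (hK : K * ρ ≤ 1 / 2) (hB : B * ρ ≤ r) (hρ : 0 < ρ)
    (hlip : LipschitzOnWith K F (closedBall p r)) (hbd : ∀ a ∈ closedBall p r, ‖F a‖ ≤ B)
    (hhol : ∀ φ : ℂ → E, DifferentiableOn ℂ φ (ball 0 ρ) →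
      MapsTo φ (ball 0 ρ) (closedBall p r) → DifferentiableOn ℂ (fun z => F (φ z)) (ball 0 ρ)) :
    ∃ φ : ℂ → E, φ 0 = p ∧ ∀ z ∈ ball (0 : ℂ) ρ,
      φ z ∈ closedBall p r ∧ HasDerivAt φ (F (φ z)) z := by
  have h0 : (0 : ℂ) ∈ ball (0 : ℂ) ρ := mem_ball_self hρ
  have step : ∀ φ : {φ : ℂ → E // DifferentiableOn ℂ φ (ball 0 ρ) ∧
      MapsTo φ (ball 0 ρ) (closedBall p r)},
      ∃ ψ : {φ : ℂ → E // DifferentiableOn ℂ φ (ball 0 ρ) ∧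
        MapsTo φ (ball 0 ρ) (closedBall p r)}, ψ.1 0 = p ∧
        ∀ z ∈ ball (0 : ℂ) ρ, HasDerivAt ψ.1 (F (φ.1 z)) z := by
    rintro ⟨φ, hφ, hm⟩
    -- The Picard operator: on a disc, the holomorphic function F ∘ φ has a primitive with value `p`
    -- at 0. The condition B ρ ≤ r keeps it in the ball.
    obtain ⟨ψ, hψ0, hψ⟩ := (hhol φ hφ hm).isExactOn_ball.with_val_at 0 p
    refine ⟨⟨ψ, fun z hz => (hψ z hz).differentiableAt.differentiableWithinAt, fun z hz => ?_⟩,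
      hψ0, hψ⟩
    have := Convex.norm_image_sub_le_of_norm_hasDerivWithin_le
      (fun w hw => (hψ w hw).hasDerivWithinAt) (fun w hw => hbd _ (hm hw))
      (convex_ball (0 : ℂ) ρ) h0 hz
    rw [mem_closedBall, dist_eq_norm, ← hψ0]
    refine this.trans (le_trans ?_ hB)
    have hz' : ‖z - 0‖ ≤ ρ := by simpa using (mem_ball_zero_iff.1 hz).le
    gcongr
  choose S hS0 hS using step
  let u : ℕ → {φ : ℂ → E // DifferentiableOn ℂ φ (ball 0 ρ) ∧
      MapsTo φ (ball 0 ρ) (closedBall p r)} := fun k => S^[k]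
    ⟨fun _ => p, differentiableOn_const _, fun _ _ => mem_closedBall_self hr⟩
  have hu : ∀ k, u (k + 1) = S (u k) := fun k => Function.iterate_succ_apply' _ _ _
  have hd : ∀ k, ∀ z ∈ ball (0 : ℂ) ρ, HasDerivAt (u (k + 1)).1 (F ((u k).1 z)) z := by
    intro k z hz
    rw [hu]
    exact hS _ z hz
  have hu0 : ∀ k, (u k).1 0 = p := by
    intro k
    cases k with
    | zero => rfl
    | succ k => rw [hu]; exact hS0 _
  -- Since K ρ ≤ 1 / 2, each Picard step at least halves the distance between successive iterates.
  have hgeo : ∀ k, ∀ z ∈ ball (0 : ℂ) ρ, dist ((u k).1 z) ((u (k + 1)).1 z) ≤ r * (1 / 2) ^ k := by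
    intro k
    induction k with
    | zero =>
      intro z hz
      rw [pow_zero, mul_one, dist_comm]
      exact mem_closedBall.1 ((u 1).2.2 hz)
    | succ k ih =>
      intro z hz
      have hb : ∀ w ∈ ball (0 : ℂ) ρ, ‖F ((u (k + 1)).1 w) - F ((u k).1 w)‖ ≤
          K * (r * (1 / 2) ^ k) := by
        intro w hw
        rw [← dist_eq_norm, dist_comm]
        refine (hlip.dist_le_mul _ ((u k).2.2 hw) _ ((u (k + 1)).2.2 hw)).trans ?_
        gcongr
        exact ih w hw
      have := Convex.norm_image_sub_le_of_norm_hasDerivWithin_le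
        (f := fun w => (u (k + 1 + 1)).1 w - (u (k + 1)).1 w)
        (fun w hw => ((hd (k + 1) w hw).sub (hd k w hw)).hasDerivWithinAt) hb
        (convex_ball (0 : ℂ) ρ) h0 hz
      simp only [hu0, sub_self, sub_zero] at this
      rw [dist_comm, dist_eq_norm]
      refine this.trans ?_
      have hz' : ‖z‖ ≤ ρ := (mem_ball_zero_iff.1 hz).le
      calc K * (r * (1 / 2) ^ k) * ‖z‖ ≤ K * (r * (1 / 2) ^ k) * ρ := by gcongr
        _ = (K * ρ) * (r * (1 / 2) ^ k) := by ring
        _ ≤ 1 / 2 * (r * (1 / 2) ^ k) := by gcongr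
        _ = r * (1 / 2) ^ (k + 1) := by ring
  have hlim : ∀ z, ∃ l, z ∈ ball (0 : ℂ) ρ → Tendsto (fun k => (u k).1 z) atTop (𝓝 l) := by
    intro z
    by_cases hz : z ∈ ball (0 : ℂ) ρ
    · obtain ⟨l, hl⟩ := cauchySeq_tendsto_of_complete
        (cauchySeq_of_le_geometric (1 / 2) r (by norm_num) fun k => hgeo k z hz)
      exact ⟨l, fun _ => hl⟩
    · exact ⟨0, fun h => absurd h hz⟩
  choose φ hφ using hlim
  have hmem : ∀ z ∈ ball (0 : ℂ) ρ, φ z ∈ closedBall p r := fun z hz =>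
    isClosed_closedBall.mem_of_tendsto (hφ z hz) (Eventually.of_forall fun k => (u k).2.2 hz)
  have hunif : TendstoUniformlyOn (fun k z => F ((u k).1 z)) (fun z => F (φ z)) atTop
      (ball (0 : ℂ) ρ) := by
    rw [Metric.tendstoUniformlyOn_iff]
    intro ε hε
    have ht : Tendsto (fun k : ℕ => (K : ℝ) * (r * (1 / 2) ^ k / (1 - 1 / 2))) atTop (𝓝 0) := by
      have := ((tendsto_pow_atTop_nhds_zero_of_lt_one (r := (1 / 2 : ℝ)) (by norm_num)
        (by norm_num)).const_mul r).div_const (1 - 1 / 2) |>.const_mul (K : ℝ)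
      simpa using this
    filter_upwards [ht.eventually_lt_const hε] with k hk z hz
    refine lt_of_le_of_lt ?_ hk
    rw [dist_comm]
    refine (hlip.dist_le_mul _ ((u k).2.2 hz) _ (hmem z hz)).trans ?_
    gcongr
    exact dist_le_of_le_geometric_of_tendsto (1 / 2) r (by norm_num) (fun k => hgeo k z hz)
      (hφ z hz) k
  refine ⟨φ, ?_, fun z hz => ⟨hmem z hz, ?_⟩⟩
  · refine tendsto_nhds_unique (hφ 0 h0) ?_
    simp only [hu0]
    exact tendsto_const_nhds
  -- F (u k) is the derivative of u (k + 1), whence the index shift: uniform convergence of these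
  -- derivatives allows passage to the limit.
  · exact hasDerivAt_of_tendstoUniformlyOn isOpen_ball hunif
      (Eventually.of_forall fun k w hw => hd k w hw)
      (fun w hw => (tendsto_add_atTop_iff_nat 1).2 (hφ w hw)) hz

/-- Uniqueness for an autonomous differential equation on an interval of any shape, with the
value prescribed at any of its points. -/
theorem eqOn_of_hasDerivWithinAt_ordConnected {E : Type*} [NormedAddCommGroup E] [NormedSpace ℝ E]
    {F : E → E} {s : Set E} {K : ℝ≥0} (hlip : LipschitzOnWith K F s) {J : Set ℝ}
    (hJ : J.OrdConnected) {f g : ℝ → E}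
    (hf : ∀ t ∈ J, HasDerivWithinAt f (F (f t)) J t) (hfs : ∀ t ∈ J, f t ∈ s)
    (hg : ∀ t ∈ J, HasDerivWithinAt g (F (g t)) J t) (hgs : ∀ t ∈ J, g t ∈ s)
    {a : ℝ} (ha : a ∈ J) (hfg : f a = g a) : EqOn f g J := by
  intro t ht
  rcases le_total a t with h | h
  · have hsub : Icc a t ⊆ J := hJ.out ha ht
    have key : ∀ {e : ℝ → E}, (∀ t ∈ J, HasDerivWithinAt e (F (e t)) J t) →
        ∀ s ∈ Ico a t, HasDerivWithinAt e (F (e s)) (Ici s) s := fun he s hs =>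
      (he s (hsub (Ico_subset_Icc_self hs))).mono_of_mem_nhdsWithin
        (mem_of_superset (Icc_mem_nhdsGE hs.2) ((Icc_subset_Icc_left hs.1).trans hsub))
    exact ODE_solution_unique_of_mem_Icc_right (v := fun _ => F) (s := fun _ => s)
      (fun _ _ => hlip) (fun w hw => ((hf w (hsub hw)).continuousWithinAt.mono hsub)) (key hf)
      (fun w hw => hfs w (hsub (Ico_subset_Icc_self hw)))
      (fun w hw => ((hg w (hsub hw)).continuousWithinAt.mono hsub)) (key hg)
      (fun w hw => hgs w (hsub (Ico_subset_Icc_self hw))) hfg ⟨h, le_rfl⟩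
  · have hsub : Icc t a ⊆ J := hJ.out ht ha
    have key : ∀ {e : ℝ → E}, (∀ t ∈ J, HasDerivWithinAt e (F (e t)) J t) →
        ∀ s ∈ Ioc t a, HasDerivWithinAt e (F (e s)) (Iic s) s := fun he s hs =>
      (he s (hsub (Ioc_subset_Icc_self hs))).mono_of_mem_nhdsWithin
        (mem_of_superset (Icc_mem_nhdsLE hs.1) ((Icc_subset_Icc_right hs.2).trans hsub))
    exact ODE_solution_unique_of_mem_Icc_left (v := fun _ => F) (s := fun _ => s)
      (fun _ _ => hlip) (fun w hw => ((hf w (hsub hw)).continuousWithinAt.mono hsub)) (key hf)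
      (fun w hw => hfs w (hsub (Ioc_subset_Icc_self hw)))
      (fun w hw => ((hg w (hsub hw)).continuousWithinAt.mono hsub)) (key hg)
      (fun w hw => hgs w (hsub (Ioc_subset_Icc_self hw))) hfg ⟨le_rfl, h⟩

/-- A solution on a ray is assembled from solutions on arbitrarily long initial segments. -/
theorem exists_hasDerivWithinAt_Ici_of_forall_Icc {E : Type*} [NormedAddCommGroup E]
    [NormedSpace ℝ E] {F : E → E} {s : Set E} {K : ℝ≥0} (hlip : LipschitzOnWith K F s)
    {t₀ δ : ℝ} (hδ : 0 < δ) {c₀ : E}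
    (h : ∀ k : ℕ, ∃ c : ℝ → E, c t₀ = c₀ ∧ ∀ t ∈ Icc t₀ (t₀ + k * δ),
      HasDerivWithinAt c (F (c t)) (Icc t₀ (t₀ + k * δ)) t ∧ c t ∈ s) :
    ∃ c : ℝ → E, c t₀ = c₀ ∧
      ∀ t ∈ Ici t₀, HasDerivWithinAt c (F (c t)) (Ici t₀) t ∧ c t ∈ s := by
  choose d hd0 hd using h
  have hmono : ∀ k l : ℕ, k ≤ l → Icc t₀ (t₀ + k * δ) ⊆ Icc t₀ (t₀ + l * δ) := by
    intro k l hkl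
    apply Icc_subset_Icc_right
    gcongr
  have hle : ∀ k l : ℕ, k ≤ l → EqOn (d k) (d l) (Icc t₀ (t₀ + k * δ)) := by
    intro k l hkl
    exact eqOn_of_hasDerivWithinAt_ordConnected hlip ordConnected_Icc
      (fun t ht => (hd k t ht).1) (fun t ht => (hd k t ht).2)
      (fun t ht => (hd l t (hmono k l hkl ht)).1.mono (hmono k l hkl))
      (fun t ht => (hd l t (hmono k l hkl ht)).2)
      (left_mem_Icc.2 (by linarith [show (0 : ℝ) ≤ k * δ by positivity])) ((hd0 k).trans (hd0 l).symm)
  let N : ℝ → ℕ := fun t => ⌈(t - t₀) / δ⌉₊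
  have hN : ∀ t, t ≤ t₀ + N t * δ := by
    intro t
    have : (t - t₀) / δ ≤ N t := Nat.le_ceil _
    rw [div_le_iff₀ hδ] at this
    linarith
  let c : ℝ → E := fun t => d (N t) t
  have hc : ∀ k : ℕ, EqOn c (d k) (Icc t₀ (t₀ + k * δ)) := by
    intro k t ht
    rcases le_total k (N t) with hk | hk
    · exact (hle k (N t) hk ht).symm
    · exact hle (N t) k hk ⟨ht.1, hN t⟩
  refine ⟨c, hd0 _, fun t ht => ?_⟩
  -- One more segment than `N t` makes the inequality strict, so that the segment is a neighbourhood
  -- of `t` within the ray.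
  have hlt : t < t₀ + (N t + 1 : ℕ) * δ := by
    have := hN t
    push_cast
    linarith
  have htm : t ∈ Icc t₀ (t₀ + (N t + 1 : ℕ) * δ) := ⟨ht, hlt.le⟩
  have hct := hc (N t + 1) htm
  refine ⟨?_, hct ▸ (hd _ t htm).2⟩
  rw [hct]
  refine ((hd _ t htm).1.congr (hc _) hct).mono_of_mem_nhdsWithin ?_
  rw [← Ici_inter_Iic]
  exact inter_mem self_mem_nhdsWithin (mem_nhdsWithin_of_mem_nhds (Iic_mem_nhds hlt))

/-- Global existence for a holomorphic differential equation, from an a priori bound: if solutions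
which stay in a ball of radius `r'` in fact stay in a ball of smaller radius `r`, then the solution
exists for all later times. -/
theorem exists_hasDerivWithinAt_Ici_of_apriori {E : Type*} [NormedAddCommGroup E]
    [NormedSpace ℂ E] [CompleteSpace E] {F : E → E} {p : E} {r r' : ℝ} {K B : ℝ≥0} (hr : r < r')
    (hlip : LipschitzOnWith K F (closedBall p r')) (hbd : ∀ a ∈ closedBall p r', ‖F a‖ ≤ B)
    (hhol : ∀ (U : Set ℂ), IsOpen U → ∀ φ : ℂ → E, DifferentiableOn ℂ φ U →
      MapsTo φ U (closedBall p r') → DifferentiableOn ℂ (fun z => F (φ z)) U)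
    {t₀ : ℝ} {c₀ : E} (hc₀ : c₀ ∈ closedBall p r')
    (apriori : ∀ (T : ℝ) (c : ℝ → E), t₀ ≤ T → c t₀ = c₀ →
      (∀ t ∈ Icc t₀ T, HasDerivWithinAt c (F (c t)) (Icc t₀ T) t ∧ c t ∈ closedBall p r') →
      ∀ t ∈ Icc t₀ T, c t ∈ closedBall p r) :
    ∃ c : ℝ → E, c t₀ = c₀ ∧
      ∀ t ∈ Ici t₀, HasDerivWithinAt c (F (c t)) (Ici t₀) t ∧ c t ∈ closedBall p r' := by
  have hd : 0 < r' - r := sub_pos.2 hr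
  obtain ⟨ρ, hρ, hKρ, hBρ⟩ := exists_pos_mul_le_half_and_mul_le K B hd
  have hδ : 0 < ρ / 2 := by positivity
  -- Each step advances by ρ / 2, so that the closed time interval fits in the open disc of radius
  -- ρ; ρ depends only on `K`, `B` and r' - r.
  refine exists_hasDerivWithinAt_Ici_of_forall_Icc hlip hδ fun k => ?_
  induction k with
  | zero =>
    refine ⟨fun _ => c₀, rfl, fun t ht => ⟨?_, hc₀⟩⟩
    have : Icc t₀ (t₀ + (0 : ℕ) * (ρ / 2)) = {t₀} := by simp
    rw [this] at ht ⊢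
    rw [mem_singleton_iff.1 ht]
    rw [hasDerivWithinAt_iff_hasFDerivWithinAt]
    exact .of_subsingleton subsingleton_singleton
  | succ k ih =>
    obtain ⟨c, hc0, hc⟩ := ih
    set T : ℝ := t₀ + k * (ρ / 2) with hT
    have h0T : t₀ ≤ T := by linarith [show (0 : ℝ) ≤ k * (ρ / 2) by positivity]
    have hT' : t₀ + (k + 1 : ℕ) * (ρ / 2) = T + ρ / 2 := by push_cast; rw [hT]; ring
    rw [hT']
    -- The endpoint lies in the smaller ball, so there is again room r' - r for the next local
    -- solution.
    have hcT := apriori T c h0T hc0 hc T ⟨h0T, le_rfl⟩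
    have hsub : closedBall (c T) (r' - r) ⊆ closedBall p r' := by
      apply closedBall_subset_closedBall'
      linarith [mem_closedBall.1 hcT]
    obtain ⟨φ, hφ0, hφ⟩ := exists_holomorphic_hasDerivAt hd.le hKρ hBρ hρ (hlip.mono hsub)
      (fun a ha => hbd a (hsub ha))
      (fun φ h1 h2 => hhol _ isOpen_ball φ h1 (h2.mono_right hsub))
    have hball : ∀ t ∈ Icc T (T + ρ / 2), ((t - T : ℝ) : ℂ) ∈ ball (0 : ℂ) ρ := by
      intro t ht
      rw [mem_ball_zero_iff, Complex.norm_real, Real.norm_of_nonneg (sub_nonneg.2 ht.1)]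
      linarith [ht.2]
    let ψ : ℝ → E := fun t => φ ((t - T : ℝ) : ℂ)
    have hψT : ψ T = c T := by simp [ψ, hφ0]
    have hψ : ∀ t ∈ Icc T (T + ρ / 2), HasDerivAt ψ (F (ψ t)) t ∧ ψ t ∈ closedBall p r' := by
      intro t ht
      refine ⟨?_, hsub (hφ _ (hball t ht)).1⟩
      have hs : HasDerivAt (fun t : ℝ => ((t - T : ℝ) : ℂ)) 1 t := by
        simpa using ((hasDerivAt_id t).sub_const T).ofReal_comp
      have := (hφ _ (hball t ht)).2.scomp t hs
      rw [one_smul] at this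
      exact this
    let e : ℝ → E := fun t => if t ≤ T then c t else ψ t
    have he1 : EqOn e c (Icc t₀ T) := fun t ht => if_pos ht.2
    have he2 : EqOn e ψ (Icc T (T + ρ / 2)) := by
      intro t ht
      rcases eq_or_lt_of_le ht.1 with h | h
      · simp [e, ← h, hψT]
      · exact if_neg (not_le.2 h)
    have hun : Icc t₀ (T + ρ / 2) = Icc t₀ T ∪ Icc T (T + ρ / 2) :=
      (Icc_union_Icc_eq_Icc h0T (by linarith)).symm
    refine ⟨e, (he1 ⟨le_rfl, h0T⟩).trans hc0, fun t ht => ⟨?_, ?_⟩⟩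
    · rw [hun]
      refine HasDerivWithinAt.union ?_ ?_
      · by_cases h : t ∈ Icc t₀ T
        · rw [he1 h]
          exact (hc t h).1.congr he1 (he1 h)
        · exact HasFDerivWithinAt.of_notMem_closure (by rwa [isClosed_Icc.closure_eq])
      · by_cases h : t ∈ Icc T (T + ρ / 2)
        · rw [he2 h]
          exact (hψ t h).1.hasDerivWithinAt.congr he2 (he2 h)
        · exact HasFDerivWithinAt.of_notMem_closure (by rwa [isClosed_Icc.closure_eq])
    · rw [hun] at ht
      rcases ht with h | h
      · rw [he1 h]; exact (hc t h).2
      · rw [he2 h]; exact (hψ t h).2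

end ODE

/-! ### The logarithm series in a Banach algebra. -/

section LogSeries

/-- The Mercator series `∑ b ^ (k + 1) / (k + 1)`, which is `-log (1 - b)` for `‖b‖ < 1`. -/
noncomputable def mercatorSeries {A : Type*} [NormedRing A] [NormedAlgebra ℂ A] (b : A) : A :=
  ∑' k : ℕ, ((k : ℂ) + 1)⁻¹ • b ^ (k + 1)

/-- Telescoping without commutativity. Positive exponents avoid any assumption on ‖1‖. -/
theorem norm_pow_succ_sub_pow_succ_le {A : Type*} [NormedRing A] {a b : A} {r : ℝ}
    (ha : ‖a‖ ≤ r) (hb : ‖b‖ ≤ r) (k : ℕ) :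
    ‖a ^ (k + 1) - b ^ (k + 1)‖ ≤ (k + 1) * r ^ k * ‖a - b‖ := by
  have hr : 0 ≤ r := (norm_nonneg a).trans ha
  induction k with
  | zero => simp
  | succ k ih =>
    have hb' : ‖b ^ (k + 1)‖ ≤ r ^ (k + 1) :=
      (norm_pow_le' b k.succ_pos).trans (pow_le_pow_left₀ (norm_nonneg b) hb _)
    calc ‖a ^ (k + 1 + 1) - b ^ (k + 1 + 1)‖
        = ‖a * (a ^ (k + 1) - b ^ (k + 1)) + (a - b) * b ^ (k + 1)‖ := by
          rw [pow_succ' a (k + 1), pow_succ' b (k + 1)]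
          congr 1
          noncomm_ring
      _ ≤ ‖a‖ * ‖a ^ (k + 1) - b ^ (k + 1)‖ + ‖a - b‖ * ‖b ^ (k + 1)‖ :=
          (norm_add_le _ _).trans (add_le_add (norm_mul_le _ _) (norm_mul_le _ _))
      _ ≤ r * ((k + 1) * r ^ k * ‖a - b‖) + ‖a - b‖ * r ^ (k + 1) := by gcongr
      _ = ((k + 1 : ℕ) + 1) * r ^ (k + 1) * ‖a - b‖ := by push_cast; ring

theorem norm_natCast_add_one_inv (k : ℕ) : ‖((k : ℂ) + 1)⁻¹‖ = ((k : ℝ) + 1)⁻¹ := by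
  rw [norm_inv, ← Nat.cast_add_one, Complex.norm_natCast, Nat.cast_add_one]

theorem norm_mercatorSeries_term_le {A : Type*} [NormedRing A] [NormedAlgebra ℂ A] {b : A} {r : ℝ}
    (hb : ‖b‖ ≤ r) (k : ℕ) : ‖((k : ℂ) + 1)⁻¹ • b ^ (k + 1)‖ ≤ r ^ (k + 1) := by
  rw [norm_smul, norm_natCast_add_one_inv]
  have h1 : ((k : ℝ) + 1)⁻¹ ≤ 1 := inv_le_one_of_one_le₀ (by linarith [Nat.cast_nonneg (α := ℝ) k])
  have h2 : ‖b ^ (k + 1)‖ ≤ r ^ (k + 1) :=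
    (norm_pow_le' b k.succ_pos).trans (pow_le_pow_left₀ (norm_nonneg b) hb _)
  calc _ ≤ 1 * r ^ (k + 1) := by gcongr
    _ = _ := one_mul _

variable {A : Type*} [NormedRing A] [NormedAlgebra ℂ A] [CompleteSpace A]

theorem summable_mercatorSeries {b : A} (hb : ‖b‖ < 1) :
    Summable fun k : ℕ => ((k : ℂ) + 1)⁻¹ • b ^ (k + 1) :=
  .of_norm_bounded ((_root_.summable_nat_add_iff 1).2 (summable_geometric_of_lt_one (norm_nonneg b) hb))
    fun k => norm_mercatorSeries_term_le le_rfl k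

/-- The factor k + 1 in the Lipschitz bound for powers cancels the coefficient, leaving the
geometric series ∑ r ^ k. -/
theorem lipschitzOnWith_mercatorSeries {r : ℝ} (hr : r < 1) :
    LipschitzOnWith (1 - r)⁻¹.toNNReal (mercatorSeries : A → A) (closedBall 0 r) := by
  refine LipschitzOnWith.of_dist_le_mul fun a ha b hb => ?_
  rw [mem_closedBall_zero_iff] at ha hb
  have hr0 : 0 ≤ r := (norm_nonneg a).trans ha
  rw [Real.coe_toNNReal _ (inv_nonneg.2 (sub_nonneg.2 hr.le)), dist_eq_norm, dist_eq_norm,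
    mercatorSeries, mercatorSeries, ← (summable_mercatorSeries (ha.trans_lt hr)).tsum_sub
      (summable_mercatorSeries (hb.trans_lt hr))]
  refine tsum_of_norm_bounded ((hasSum_geometric_of_lt_one hr0 hr).mul_right ‖a - b‖) fun k => ?_
  rw [← smul_sub, norm_smul, norm_natCast_add_one_inv]
  have hk : (0 : ℝ) < k + 1 := by positivity
  calc _ ≤ ((k : ℝ) + 1)⁻¹ * ((k + 1) * r ^ k * ‖a - b‖) := by
        gcongr
        exact norm_pow_succ_sub_pow_succ_le ha hb k
    _ = r ^ k * ‖a - b‖ := by field_simp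

theorem DifferentiableOn.mercatorSeries {U : Set ℂ} (hU : IsOpen U) {φ : ℂ → A} {r : ℝ}
    (hr : r < 1) (hφ : DifferentiableOn ℂ φ U) (hm : MapsTo φ U (closedBall 0 r)) :
    DifferentiableOn ℂ (fun z => mercatorSeries (φ z)) U := by
  rcases U.eq_empty_or_nonempty with rfl | ⟨w, hw⟩
  · exact differentiableOn_empty
  have hr0 : 0 ≤ r := (norm_nonneg _).trans (mem_closedBall_zero_iff.1 (hm hw))
  exact Complex.differentiableOn_tsum_of_summable_norm
    ((_root_.summable_nat_add_iff 1).2 (summable_geometric_of_lt_one hr0 hr))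
    (fun k => (hφ.fun_pow (k + 1)).fun_const_smul _) hU
    fun k w hw => norm_mercatorSeries_term_le (mem_closedBall_zero_iff.1 (hm hw)) k

end LogSeries

/-! ### Functional calculus of a Hermitian matrix in its eigenbasis. -/

section Spectral

variable {n : ℕ} {a : Matrix (Fin n) (Fin n) ℂ}

/-- The matrix with the eigenvectors of the Hermitian matrix `a` and with prescribed
eigenvalues `d`. -/
noncomputable def Matrix.IsHermitian.eigenDiagonal (ha : a.IsHermitian) (d : Fin n → ℂ) :
    Matrix (Fin n) (Fin n) ℂ :=
  (ha.eigenvectorUnitary : Matrix (Fin n) (Fin n) ℂ) * Matrix.diagonal d *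
    star (ha.eigenvectorUnitary : Matrix (Fin n) (Fin n) ℂ)

namespace Matrix.IsHermitian

theorem eigenDiagonal_eigenvalues (ha : a.IsHermitian) :
    ha.eigenDiagonal (fun i => (ha.eigenvalues i : ℂ)) = a := by
  conv_rhs => rw [ha.spectral_theorem, Unitary.conjStarAlgAut_apply]
  rfl

theorem cfc_eq_eigenDiagonal (ha : a.IsHermitian) (f : ℝ → ℝ) :
    _root_.cfc f a = ha.eigenDiagonal fun i => (f (ha.eigenvalues i) : ℂ) := by
  rw [ha.cfc_eq, Matrix.IsHermitian.cfc, Unitary.conjStarAlgAut_apply]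
  rfl

theorem eigenDiagonal_mul (ha : a.IsHermitian) (d e : Fin n → ℂ) :
    ha.eigenDiagonal d * ha.eigenDiagonal e = ha.eigenDiagonal (d * e) := by
  have h : star (ha.eigenvectorUnitary : Matrix (Fin n) (Fin n) ℂ) *
      (ha.eigenvectorUnitary : Matrix (Fin n) (Fin n) ℂ) = 1 :=
    Unitary.coe_star_mul_self _
  have h2 : Matrix.diagonal (d * e) = Matrix.diagonal d * Matrix.diagonal e := by
    rw [Matrix.diagonal_mul_diagonal]; rfl
  rw [eigenDiagonal, eigenDiagonal, eigenDiagonal, h2]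
  simp only [mul_assoc]
  rw [← mul_assoc (star _), h, one_mul]

theorem eigenDiagonal_one (ha : a.IsHermitian) : ha.eigenDiagonal 1 = 1 := by
  rw [eigenDiagonal, show Matrix.diagonal (1 : Fin n → ℂ) = 1 from Matrix.diagonal_one, mul_one]
  exact Unitary.coe_mul_star_self _

theorem eigenDiagonal_pow (ha : a.IsHermitian) (d : Fin n → ℂ) (k : ℕ) :
    ha.eigenDiagonal d ^ k = ha.eigenDiagonal (d ^ k) := by
  induction k with
  | zero => rw [pow_zero, pow_zero, eigenDiagonal_one]
  | succ k ih => rw [pow_succ, ih, eigenDiagonal_mul, pow_succ]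

theorem eigenDiagonal_sub (ha : a.IsHermitian) (d e : Fin n → ℂ) :
    ha.eigenDiagonal d - ha.eigenDiagonal e = ha.eigenDiagonal (d - e) := by
  have h2 : Matrix.diagonal (d - e) = Matrix.diagonal d - Matrix.diagonal e :=
    (Matrix.diagonal_sub d e).symm
  rw [eigenDiagonal, eigenDiagonal, eigenDiagonal, h2, mul_sub, sub_mul]

theorem eigenDiagonal_smul (ha : a.IsHermitian) (z : ℂ) (d : Fin n → ℂ) :
    z • ha.eigenDiagonal d = ha.eigenDiagonal (z • d) := by
  rw [eigenDiagonal, eigenDiagonal, Matrix.diagonal_smul, mul_smul_comm, smul_mul_assoc]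

theorem hasSum_eigenDiagonal {ι : Type*} (ha : a.IsHermitian) {f : ι → Fin n → ℂ} {d : Fin n → ℂ}
    (h : HasSum f d) : HasSum (fun k => ha.eigenDiagonal (f k)) (ha.eigenDiagonal d) :=
  (h.matrix_diagonal.mul_left _).mul_right _

theorem norm_eigenDiagonal (ha : a.IsHermitian) (d : Fin n → ℂ) : ‖ha.eigenDiagonal d‖ = ‖d‖ := by
  rw [eigenDiagonal, ← Unitary.coe_star, CStarRing.norm_mul_coe_unitary,
    CStarRing.norm_coe_unitary_mul, Matrix.l2_opNorm_diagonal]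

theorem trace_eigenDiagonal (ha : a.IsHermitian) (d : Fin n → ℂ) :
    (ha.eigenDiagonal d).trace = ∑ i, d i := by
  rw [eigenDiagonal, Matrix.trace_mul_comm, ← mul_assoc, Unitary.coe_star_mul_self, one_mul,
    Matrix.trace_diagonal]

theorem inv_eq_eigenDiagonal (ha : a.IsHermitian) (h : ∀ i, ha.eigenvalues i ≠ 0) :
    a⁻¹ = ha.eigenDiagonal fun i => ((ha.eigenvalues i)⁻¹ : ℂ) := by
  refine Matrix.inv_eq_right_inv ?_
  conv_lhs => enter [1]; rw [← ha.eigenDiagonal_eigenvalues]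
  rw [eigenDiagonal_mul, ← ha.eigenDiagonal_one]
  congr 1
  ext i
  exact mul_inv_cancel₀ (Complex.ofReal_ne_zero.2 (h i))

theorem sub_smul_one_eq_eigenDiagonal (ha : a.IsHermitian) (R : ℝ) :
    a - (R : ℂ) • 1 = ha.eigenDiagonal fun i => ((ha.eigenvalues i - R : ℝ) : ℂ) := by
  conv_lhs => enter [1]; rw [← ha.eigenDiagonal_eigenvalues]
  rw [← ha.eigenDiagonal_one, eigenDiagonal_smul, eigenDiagonal_sub]
  congr 1
  ext i
  simp

/-- The operator norm is unitarily invariant and is the sup norm on diagonal matrices. This turns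
eigenvalue bounds into membership in a ball, and back. -/
theorem norm_sub_smul_one_le_iff (ha : a.IsHermitian) {R r : ℝ} (hr : 0 ≤ r) :
    ‖a - (R : ℂ) • 1‖ ≤ r ↔ ∀ i, |ha.eigenvalues i - R| ≤ r := by
  rw [ha.sub_smul_one_eq_eigenDiagonal, norm_eigenDiagonal, pi_norm_le_iff_of_nonneg hr]
  simp only [Complex.norm_real, Real.norm_eq_abs]

theorem posDef_of_norm_sub_smul_one_lt (ha : a.IsHermitian) {R : ℝ}
    (h : ‖a - (R : ℂ) • 1‖ < R) : a.PosDef := by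
  rw [ha.posDef_iff_eigenvalues_pos]
  intro i
  have := (ha.norm_sub_smul_one_le_iff (R := R) (norm_nonneg _)).1 le_rfl i
  linarith [(abs_le.1 this).1]

/-- The logarithm of a Hermitian matrix in the ball of radius `R` around `R • 1`, as a convergent
power series. -/
theorem log_eq_sub_mercatorSeries (ha : a.IsHermitian) {R : ℝ} (h : ‖a - (R : ℂ) • 1‖ < R) :
    CFC.log a = ((Real.log R : ℝ) : ℂ) • 1 - mercatorSeries (1 - (R : ℂ)⁻¹ • a) := by
  have hR : 0 < R := (norm_nonneg _).trans_lt h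
  have h1 : (1 - (R : ℂ)⁻¹ • a) =
      ha.eigenDiagonal fun i => ((1 - R⁻¹ * ha.eigenvalues i : ℝ) : ℂ) := by
    conv_lhs => enter [2, 2]; rw [← ha.eigenDiagonal_eigenvalues]
    rw [← ha.eigenDiagonal_one, eigenDiagonal_smul, eigenDiagonal_sub]
    congr 1
    ext i
    simp
  have h2 : HasSum (fun k : ℕ => ((k : ℂ) + 1)⁻¹ • (1 - (R : ℂ)⁻¹ • a) ^ (k + 1))
      (ha.eigenDiagonal fun i => ((-Real.log (R⁻¹ * ha.eigenvalues i) : ℝ) : ℂ)) := by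
    simp only [h1, eigenDiagonal_pow, eigenDiagonal_smul]
    refine ha.hasSum_eigenDiagonal (Pi.hasSum.2 fun i => ?_)
    have hi : |1 - R⁻¹ * ha.eigenvalues i| < 1 := by
      have := ((ha.norm_sub_smul_one_le_iff (R := R) (norm_nonneg _)).1 le_rfl i).trans_lt h
      rw [show 1 - R⁻¹ * ha.eigenvalues i = -(R⁻¹ * (ha.eigenvalues i - R)) by field_simp; ring,
        abs_neg, abs_mul, abs_of_pos (inv_pos.2 hR), inv_mul_lt_iff₀ hR, mul_one]
      exact this
    have := (Real.hasSum_pow_div_log_of_abs_lt_one hi)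
    rw [sub_sub_cancel] at this
    have h3 := Complex.hasSum_ofReal.2 this
    convert h3 using 2 with k
    simp [div_eq_inv_mul]
  rw [mercatorSeries, h2.tsum_eq, CFC.log, ha.cfc_eq_eigenDiagonal, ← ha.eigenDiagonal_one,
    eigenDiagonal_smul, eigenDiagonal_sub]
  congr 1
  ext i
  have hi := (ha.posDef_of_norm_sub_smul_one_lt h).eigenvalues_pos i
  have : Real.log (R⁻¹ * ha.eigenvalues i) = -Real.log R + Real.log (ha.eigenvalues i) := by
    rw [Real.log_mul (inv_ne_zero hR.ne') hi.ne', Real.log_inv]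
  simp [this]

end Matrix.IsHermitian

end Spectral

/-! ### The noncommutative Laplacian and its dissipativity. -/

section Laplacian

variable {n : ℕ}

theorem ncLaplacian_eq (x y a : Matrix (Fin n) (Fin n) ℂ) :
    ncLaplacian x y a = (y * (y * a - a * y) - (y * a - a * y) * y) +
      (x * (x * a - a * x) - (x * a - a * x) * x) := by
  rw [ncLaplacian, deltaOne, deltaOne, deltaTwo, deltaTwo]
  noncomm_ring

/-- The noncommutative Laplacian as a linear map. -/
def ncLaplacianLinear (x y : Matrix (Fin n) (Fin n) ℂ) :
    Matrix (Fin n) (Fin n) ℂ →ₗ[ℂ] Matrix (Fin n) (Fin n) ℂ where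
  toFun := ncLaplacian x y
  map_add' a b := by
    simp only [ncLaplacian_eq]
    noncomm_ring
  map_smul' z a := by
    simp only [ncLaplacian_eq, mul_smul_comm, smul_mul_assoc, ← smul_sub, ← smul_add,
      RingHom.id_apply]

theorem ncLaplacian_one (x y : Matrix (Fin n) (Fin n) ℂ) : ncLaplacian x y 1 = 0 := by
  simp [ncLaplacian_eq]

theorem star_ncLaplacian {x y : Matrix (Fin n) (Fin n) ℂ} (hx : x.IsHermitian)
    (hy : y.IsHermitian) (a : Matrix (Fin n) (Fin n) ℂ) :
    star (ncLaplacian x y a) = ncLaplacian x y (star a) := by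
  have hx' : star x = x := hx
  have hy' : star y = y := hy
  simp only [ncLaplacian_eq, star_add, star_sub, star_mul, hx', hy']
  noncomm_ring

theorem trace_ncLaplacian (x y a : Matrix (Fin n) (Fin n) ℂ) :
    (ncLaplacian x y a).trace = 0 := by
  simp only [ncLaplacian_eq, Matrix.trace_add, Matrix.trace_sub]
  rw [Matrix.trace_mul_comm y, Matrix.trace_mul_comm x]
  simp

/-- With E = diag(e), the i-th diagonal entry of [w, [w, E]] is ∑ j, 2 |w i j|² (eᵢ - eⱼ). As |w i
j|² is symmetric, symmetrizing in i and j gives the Dirichlet form. -/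
theorem trace_diagonal_mul_comm_comm {w : Matrix (Fin n) (Fin n) ℂ} (hw : w.IsHermitian)
    (d e : Fin n → ℝ) :
    (Matrix.diagonal (fun i => (d i : ℂ)) *
      (w * (w * Matrix.diagonal (fun i => (e i : ℂ)) - Matrix.diagonal (fun i => (e i : ℂ)) * w) -
        (w * Matrix.diagonal (fun i => (e i : ℂ)) - Matrix.diagonal (fun i => (e i : ℂ)) * w) * w)
      ).trace.re = ∑ i, ∑ j, Complex.normSq (w i j) * ((d i - d j) * (e i - e j)) := by
  have hji : ∀ i j, w j i = (starRingEnd ℂ) (w i j) := fun i j => (hw.apply i j).symm ▸ by simp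
  have hN : ∀ i j, Complex.normSq (w j i) = Complex.normSq (w i j) := fun i j => by
    rw [hji, Complex.normSq_conj]
  have h1 : ∑ i, ∑ j, Complex.normSq (w i j) * ((d i - d j) * (e i - e j)) =
      ∑ i, ∑ j, (Complex.normSq (w i j) * (d i * (e i - e j)) +
        Complex.normSq (w j i) * (d j * (e j - e i))) := by
    refine Finset.sum_congr rfl fun i _ => Finset.sum_congr rfl fun j _ => ?_
    rw [hN]; ring
  have h2 : ∑ i, ∑ j, (Complex.normSq (w i j) * (d i * (e i - e j)) +
        Complex.normSq (w j i) * (d j * (e j - e i))) =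
      ∑ i, ∑ j, d i * (2 * Complex.normSq (w i j) * (e i - e j)) := by
    simp only [Finset.sum_add_distrib]
    rw [Finset.sum_comm (f := fun i j => Complex.normSq (w j i) * (d j * (e j - e i)))]
    simp only [← Finset.sum_add_distrib]
    refine Finset.sum_congr rfl fun i _ => Finset.sum_congr rfl fun j _ => ?_
    ring
  rw [h1, h2]
  simp only [Matrix.trace, Matrix.diag, Matrix.diagonal_mul, Complex.re_sum, Complex.re_ofReal_mul,
    ← Finset.mul_sum]
  refine Finset.sum_congr rfl fun i _ => ?_
  congr 1
  rw [Matrix.sub_apply, Matrix.mul_apply, Matrix.mul_apply, ← Finset.sum_sub_distrib,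
    Complex.re_sum]
  refine Finset.sum_congr rfl fun j _ => ?_
  rw [Matrix.sub_apply, Matrix.sub_apply, Matrix.mul_diagonal, Matrix.mul_diagonal,
    Matrix.diagonal_mul, Matrix.diagonal_mul]
  rw [hji i j]
  simp [Complex.normSq_apply]
  ring

/-- Functions of a Hermitian matrix which are monotone in opposite directions pair non-positively
through the noncommutative Laplacian. -/
theorem trace_eigenDiagonal_mul_ncLaplacian_nonpos {x y a : Matrix (Fin n) (Fin n) ℂ}
    (hx : x.IsHermitian) (hy : y.IsHermitian) (ha : a.IsHermitian) {d e : Fin n → ℝ}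
    (h : ∀ i j, (d i - d j) * (e i - e j) ≤ 0) :
    (ha.eigenDiagonal (fun i => (d i : ℂ)) *
      ncLaplacian x y (ha.eigenDiagonal fun i => (e i : ℂ))).trace.re ≤ 0 := by
  have key : ∀ w : Matrix (Fin n) (Fin n) ℂ, w.IsHermitian →
      (ha.eigenDiagonal (fun i => (d i : ℂ)) *
        (w * (w * ha.eigenDiagonal (fun i => (e i : ℂ)) - ha.eigenDiagonal (fun i => (e i : ℂ)) * w)
        - (w * ha.eigenDiagonal (fun i => (e i : ℂ)) - ha.eigenDiagonal (fun i => (e i : ℂ)) * w)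
          * w)).trace.re ≤ 0 := by
    intro w hw
    set U : Matrix (Fin n) (Fin n) ℂ := ha.eigenvectorUnitary.1 with hU
    have hUU : U * star U = 1 := Unitary.coe_mul_star_self _
    have hUU' : star U * U = 1 := Unitary.coe_star_mul_self _
    have hw' : (star U * w * U).IsHermitian := by
      have : star w = w := hw
      change star (star U * w * U) = star U * w * U
      simp only [star_mul, star_star, this, mul_assoc]
    -- Passing to the eigenbasis of `a` makes both functions of `a` diagonal and replaces `w` by U*
    -- w U, still Hermitian.
    have hw2 : w = U * (star U * w * U) * star U := by
      simp only [mul_assoc, hUU, mul_one]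
      rw [← mul_assoc, hUU, one_mul]
    have hcanc : ∀ b c : Matrix (Fin n) (Fin n) ℂ,
        (U * b * star U) * (U * c * star U) = U * (b * c) * star U := by
      intro b c
      simp only [mul_assoc]
      rw [← mul_assoc (star U), hUU', one_mul]
    have hsub : ∀ b c : Matrix (Fin n) (Fin n) ℂ,
        (U * b * star U) - (U * c * star U) = U * (b - c) * star U := by
      intro b c
      rw [mul_sub, sub_mul]
    rw [hw2]
    simp only [Matrix.IsHermitian.eigenDiagonal, ← hU, hcanc, hsub]
    rw [Matrix.trace_mul_comm, ← mul_assoc, hUU', one_mul, trace_diagonal_mul_comm_comm hw']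
    exact Finset.sum_nonpos fun i _ => Finset.sum_nonpos fun j _ =>
      mul_nonpos_of_nonneg_of_nonpos (Complex.normSq_nonneg _) (h i j)
  rw [ncLaplacian_eq, mul_add, Matrix.trace_add, Complex.add_re]
  exact add_nonpos (key y hy) (key x hx)

end Laplacian

/-! ### The holomorphic extension of the vector field. -/

section Field

variable {n : ℕ}

/-- The vector field of the Ricci flow, extended holomorphically from the positive definite
matrices of norm less than `2 * R` to the ball of radius `R` around `R • 1`. -/
noncomputable def ricciField (x y : Matrix (Fin n) (Fin n) ℂ) (R : ℝ) (a : Matrix (Fin n) (Fin n) ℂ) :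
    Matrix (Fin n) (Fin n) ℂ :=
  ncLaplacian x y (mercatorSeries (1 - (R : ℂ)⁻¹ • a))

/-- The Laplacian kills the scalar term log R of the expansion of `CFC.log a`, and the Mercator
series carries the minus sign. -/
theorem ricciField_eq_neg_ncLaplacian_log (x y : Matrix (Fin n) (Fin n) ℂ) {R : ℝ}
    {a : Matrix (Fin n) (Fin n) ℂ} (ha : a.IsHermitian) (h : ‖a - (R : ℂ) • 1‖ < R) :
    ricciField x y R a = -ncLaplacian x y (CFC.log a) := by
  rw [ha.log_eq_sub_mercatorSeries h, ricciField]
  change ncLaplacianLinear x y _ = -ncLaplacianLinear x y _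
  rw [map_sub, map_smul]
  change _ = -((_ : ℂ) • ncLaplacian x y 1 - _)
  rw [ncLaplacian_one, smul_zero, zero_sub, neg_neg]

/-- The series has real coefficients. Consequently the adjoint of a solution is a solution, which
makes solutions with Hermitian initial value Hermitian. -/
theorem star_ricciField {x y : Matrix (Fin n) (Fin n) ℂ} (hx : x.IsHermitian)
    (hy : y.IsHermitian) (R : ℝ) (a : Matrix (Fin n) (Fin n) ℂ) :
    star (ricciField x y R a) = ricciField x y R (star a) := by
  rw [ricciField, ricciField, star_ncLaplacian hx hy, mercatorSeries, mercatorSeries, tsum_star]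
  congr 2
  ext1 k
  have h1 : star ((k : ℂ) + 1)⁻¹ = ((k : ℂ) + 1)⁻¹ := by simp
  have h2 : star (R : ℂ)⁻¹ = (R : ℂ)⁻¹ := by simp
  rw [star_smul, star_pow, star_sub, star_one, star_smul, h1, h2]

theorem mapsTo_one_sub_inv_smul {R r : ℝ} (hR : 0 < R) :
    MapsTo (fun a : Matrix (Fin n) (Fin n) ℂ => 1 - (R : ℂ)⁻¹ • a)
      (closedBall ((R : ℂ) • 1) r) (closedBall 0 (r / R)) := by
  intro a ha
  have hR' : (R : ℂ) ≠ 0 := Complex.ofReal_ne_zero.2 hR.ne'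
  have : 1 - (R : ℂ)⁻¹ • a = -((R : ℂ)⁻¹ • (a - (R : ℂ) • 1)) := by
    rw [smul_sub, smul_smul, inv_mul_cancel₀ hR', one_smul, neg_sub]
  rw [mem_closedBall, dist_eq_norm] at ha
  rw [mem_closedBall_zero_iff]
  beta_reduce
  rw [this, norm_neg, norm_smul, norm_inv, Complex.norm_real,
    Real.norm_of_nonneg hR.le, div_eq_inv_mul]
  gcongr

theorem exists_lipschitzOnWith_ricciField (x y : Matrix (Fin n) (Fin n) ℂ) {R r : ℝ}
    (hR : 0 < R) (hr : r < R) :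
    ∃ K, LipschitzOnWith K (ricciField x y R) (closedBall ((R : ℂ) • 1) r) := by
  have h1 : LipschitzWith ‖(R : ℂ)⁻¹‖₊
      (fun a : Matrix (Fin n) (Fin n) ℂ => 1 - (R : ℂ)⁻¹ • a) := by
    refine LipschitzWith.of_dist_le_mul fun a b => ?_
    rw [dist_eq_norm, dist_eq_norm, sub_sub_sub_cancel_left, ← smul_sub, norm_smul, coe_nnnorm,
      norm_sub_rev b a]
  have h2 := ((LinearMap.toContinuousLinearMap (ncLaplacianLinear x y)).lipschitz).comp_lipschitzOnWith
    ((lipschitzOnWith_mercatorSeries ((div_lt_one hR).2 hr)).comp h1.lipschitzOnWith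
      (mapsTo_one_sub_inv_smul (n := n) (r := r) hR))
  exact ⟨_, h2⟩

/-- The field vanishes at the centre R • 1, so the Lipschitz constant alone bounds it. -/
theorem norm_ricciField_le {x y : Matrix (Fin n) (Fin n) ℂ} {R r : ℝ} {K : ℝ≥0} (hR : 0 < R)
    (hr : 0 ≤ r) (h : LipschitzOnWith K (ricciField x y R) (closedBall ((R : ℂ) • 1) r))
    {a : Matrix (Fin n) (Fin n) ℂ} (ha : a ∈ closedBall ((R : ℂ) • 1) r) :
    ‖ricciField x y R a‖ ≤ K * r := by
  have h0 : ricciField x y R ((R : ℂ) • 1) = 0 := by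
    rw [ricciField, smul_smul, inv_mul_cancel₀ (Complex.ofReal_ne_zero.2 hR.ne'), one_smul,
      sub_self, mercatorSeries]
    simp [ncLaplacian_eq]
  have := h.dist_le_mul a ha _ (mem_closedBall_self hr)
  rw [h0, dist_zero_right] at this
  refine this.trans ?_
  gcongr
  exact ha

theorem DifferentiableOn.ricciField (x y : Matrix (Fin n) (Fin n) ℂ) {R r : ℝ}
    (hR : 0 < R) (hr : r < R) {U : Set ℂ} (hU : IsOpen U) {φ : ℂ → Matrix (Fin n) (Fin n) ℂ}
    (hφ : DifferentiableOn ℂ φ U) (hm : MapsTo φ U (closedBall ((R : ℂ) • 1) r)) :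
    DifferentiableOn ℂ (fun z => ricciField x y R (φ z)) U := by
  have h1 : DifferentiableOn ℂ (fun z => 1 - (R : ℂ)⁻¹ • φ z) U :=
    (differentiableOn_const _).sub (hφ.fun_const_smul _)
  have h2 := h1.mercatorSeries hU ((div_lt_one hR).2 hr)
    ((mapsTo_one_sub_inv_smul (n := n) hR).comp hm)
  exact (LinearMap.toContinuousLinearMap (ncLaplacianLinear x y)).differentiable.comp_differentiableOn h2

end Field

/-! ### Monotone quantities and the a priori bound. -/

section Monotonicity

variable {n : ℕ}

/-- The real part of the trace, as a continuous real linear map. -/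
noncomputable def reTraceCLM (n : ℕ) : Matrix (Fin n) (Fin n) ℂ →L[ℝ] ℝ :=
  Complex.reCLM.comp (LinearMap.toContinuousLinearMap (Matrix.traceLinearMap (Fin n) ℝ ℂ))

theorem HasDerivWithinAt.reTrace {c : ℝ → Matrix (Fin n) (Fin n) ℂ}
    {c' : Matrix (Fin n) (Fin n) ℂ} {J : Set ℝ} {t : ℝ} (h : HasDerivWithinAt c c' J t) :
    HasDerivWithinAt (fun t => (c t).trace.re) c'.trace.re J t :=
  (reTraceCLM n).hasFDerivAt.comp_hasDerivWithinAt t h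

theorem HasDerivWithinAt.matrix_inv {c : ℝ → Matrix (Fin n) (Fin n) ℂ}
    {c' : Matrix (Fin n) (Fin n) ℂ} {J : Set ℝ} {t : ℝ} (h : HasDerivWithinAt c c' J t)
    (hu : IsUnit (c t)) :
    HasDerivWithinAt (fun t => (c t)⁻¹) (-((c t)⁻¹ * c' * (c t)⁻¹)) J t := by
  obtain ⟨w, hw⟩ := hu
  have h1 := hasFDerivAt_ringInverse (𝕜 := ℝ) w
  rw [hw] at h1
  have h2 := h1.comp_hasDerivWithinAt t h
  have h3 : ((w⁻¹ : (Matrix (Fin n) (Fin n) ℂ)ˣ) : Matrix (Fin n) (Fin n) ℂ) = (c t)⁻¹ := by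
    rw [← hw, Matrix.coe_units_inv]
  simp only [Matrix.nonsing_inv_eq_ringInverse] at h3 ⊢
  rw [← h3]
  exact h2

theorem IsRicciFlowOn.antitoneOn_trace {x y : Matrix (Fin n) (Fin n) ℂ} {J : Set ℝ}
    {c : ℝ → Matrix (Fin n) (Fin n) ℂ} (hJ : Convex ℝ J)
    (hc : ∀ t ∈ J, HasDerivWithinAt c (-ncLaplacian x y (CFC.log (c t))) J t) :
    AntitoneOn (fun t => (c t).trace.re) J := by
  refine antitoneOn_of_hasDerivWithinAt_nonpos hJ
    (fun t ht => (hc t ht).reTrace.continuousWithinAt)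
    (fun t ht => (hc t (interior_subset ht)).reTrace.mono interior_subset) fun t _ => ?_
  rw [Matrix.trace_neg, trace_ncLaplacian, neg_zero, Complex.zero_re]

/-- The derivative is tr(c⁻² △ log c), and on positive eigenvalues λ⁻² decreases while log λ
increases. This bound keeps the flow away from singular matrices. -/
theorem IsRicciFlowOn.antitoneOn_trace_inv {x y : Matrix (Fin n) (Fin n) ℂ}
    (hx : x.IsHermitian) (hy : y.IsHermitian) {J : Set ℝ}
    {c : ℝ → Matrix (Fin n) (Fin n) ℂ} (hJ : Convex ℝ J) (hpos : ∀ t ∈ J, (c t).PosDef)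
    (hc : ∀ t ∈ J, HasDerivWithinAt c (-ncLaplacian x y (CFC.log (c t))) J t) :
    AntitoneOn (fun t => (c t)⁻¹.trace.re) J := by
  have hd := fun t (ht : t ∈ J) => ((hc t ht).matrix_inv (hpos t ht).isUnit).reTrace
  refine antitoneOn_of_hasDerivWithinAt_nonpos hJ
    (fun t ht => (hd t ht).continuousWithinAt)
    (fun t ht => (hd t (interior_subset ht)).mono interior_subset) fun t ht => ?_
  have hp := hpos t (interior_subset ht)
  have ha := hp.isHermitian
  have hl := hp.eigenvalues_pos
  have hinv := ha.inv_eq_eigenDiagonal fun i => (hl i).ne'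
  rw [mul_neg, neg_mul, neg_neg, Matrix.trace_mul_comm, ← mul_assoc, hinv, ha.eigenDiagonal_mul,
    CFC.log, ha.cfc_eq_eigenDiagonal]
  have := trace_eigenDiagonal_mul_ncLaplacian_nonpos hx hy ha
    (d := fun i => (ha.eigenvalues i)⁻¹ * (ha.eigenvalues i)⁻¹)
    (e := fun i => Real.log (ha.eigenvalues i)) fun i j => ?_
  · simp only [Complex.ofReal_mul, Complex.ofReal_inv] at this
    exact this
  · rcases le_total (ha.eigenvalues i) (ha.eigenvalues j) with h | h
    · have h1 := Real.log_le_log (hl i) h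
      have h2 := inv_anti₀ (hl i) h
      have h3 := inv_pos.2 (hl j)
      exact mul_nonpos_of_nonneg_of_nonpos (by nlinarith) (by linarith)
    · have h1 := Real.log_le_log (hl j) h
      have h2 := inv_anti₀ (hl j) h
      have h3 := inv_pos.2 (hl i)
      exact mul_nonpos_of_nonpos_of_nonneg (by nlinarith) (by linarith)

/-- By positivity each eigenvalue is at most the trace, and each inverse eigenvalue at most the
trace of the inverse; so the spectrum lies in [S⁻¹, R]. -/
theorem Matrix.PosDef.norm_sub_smul_one_le [NeZero n] {a : Matrix (Fin n) (Fin n) ℂ}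
    (ha : a.PosDef) {R S : ℝ} (hR : a.trace.re ≤ R) (hS : a⁻¹.trace.re ≤ S) :
    ‖a - (R : ℂ) • 1‖ ≤ R - S⁻¹ := by
  have hl := ha.eigenvalues_pos
  set l := ha.isHermitian.eigenvalues
  have hR' : ∀ i, l i ≤ R := by
    intro i
    refine le_trans ?_ hR
    rw [ha.isHermitian.trace_eq_sum_eigenvalues, Complex.re_sum]
    exact Finset.single_le_sum (f := fun i => l i) (fun j _ => (hl j).le) (Finset.mem_univ i)
  have hS' : ∀ i, S⁻¹ ≤ l i := by
    intro i
    refine inv_le_of_inv_le₀ (hl i) (le_trans ?_ hS)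
    rw [ha.isHermitian.inv_eq_eigenDiagonal fun i => (hl i).ne',
      ha.isHermitian.trace_eigenDiagonal, Complex.re_sum]
    simp only [← Complex.ofReal_inv, Complex.ofReal_re]
    exact Finset.single_le_sum (f := fun i => (l i)⁻¹) (fun j _ => (inv_pos.2 (hl j)).le)
      (Finset.mem_univ i)
  have h0 : 0 ≤ R - S⁻¹ := sub_nonneg.2 ((hS' 0).trans (hR' 0))
  rw [ha.isHermitian.norm_sub_smul_one_le_iff h0]
  intro i
  rw [abs_le]
  constructor <;> linarith [hR' i, hS' i]

theorem Matrix.PosDef.trace_re_pos [NeZero n] {a : Matrix (Fin n) (Fin n) ℂ} (ha : a.PosDef) :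
    0 < a.trace.re := by
  rw [ha.isHermitian.trace_eq_sum_eigenvalues, Complex.re_sum]
  exact Finset.sum_pos (fun i _ => ha.eigenvalues_pos i) Finset.univ_nonempty

/-- The a priori bound: along the Ricci flow the trace does not grow and the trace of the inverse
does not grow, which confines the flow to a compact set of positive definite matrices. -/
theorem norm_ricciFlow_sub_le [NeZero n] {x y : Matrix (Fin n) (Fin n) ℂ}
    (hx : x.IsHermitian) (hy : y.IsHermitian) {J : Set ℝ}
    {c : ℝ → Matrix (Fin n) (Fin n) ℂ} (hJ : Convex ℝ J) (hpos : ∀ t ∈ J, (c t).PosDef)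
    (hc : ∀ t ∈ J, HasDerivWithinAt c (-ncLaplacian x y (CFC.log (c t))) J t)
    {t₀ t : ℝ} (ht₀ : t₀ ∈ J) (ht : t ∈ J) (h : t₀ ≤ t) :
    ‖c t - (((c t₀).trace.re : ℝ) : ℂ) • 1‖ ≤ (c t₀).trace.re - ((c t₀)⁻¹.trace.re)⁻¹ :=
  (hpos t ht).norm_sub_smul_one_le (IsRicciFlowOn.antitoneOn_trace hJ hc ht₀ ht h)
    (IsRicciFlowOn.antitoneOn_trace_inv hx hy hJ hpos hc ht₀ ht h)

end Monotonicity

/-! ### Existence, uniqueness and analyticity of the Ricci flow. -/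

section Flow

variable {n : ℕ} {x y : Matrix (Fin n) (Fin n) ℂ}

/-- A solution of the extended equation which starts at a Hermitian matrix is a Ricci flow. -/
theorem posDef_and_hasDerivWithinAt_of_ricciField (hx : x.IsHermitian) (hy : y.IsHermitian)
    {R r : ℝ} (hR : 0 < R) (hr : r < R) {J : Set ℝ} (hJ : J.OrdConnected)
    {c : ℝ → Matrix (Fin n) (Fin n) ℂ}
    (hc : ∀ t ∈ J, HasDerivWithinAt c (ricciField x y R (c t)) J t ∧
      c t ∈ closedBall ((R : ℂ) • 1) r) {t₀ : ℝ} (ht₀ : t₀ ∈ J) (h₀ : (c t₀).IsHermitian) :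
    ∀ t ∈ J, (c t).PosDef ∧ HasDerivWithinAt c (-ncLaplacian x y (CFC.log (c t))) J t := by
  obtain ⟨K, hK⟩ := exists_lipschitzOnWith_ricciField x y hR hr
  have hstar : EqOn (fun t => star (c t)) c J := by
    refine eqOn_of_hasDerivWithinAt_ordConnected hK hJ (fun t ht => ?_) (fun t ht => ?_)
      (fun t ht => (hc t ht).1) (fun t ht => (hc t ht).2) ht₀ h₀
    · rw [← star_ricciField hx hy]
      exact (hc t ht).1.star
    · have h1 := (hc t ht).2
      rw [mem_closedBall, dist_eq_norm] at h1 ⊢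
      rw [← norm_star, star_sub, star_star, star_smul, star_one]
      simpa using h1
  intro t ht
  have hH : (c t).IsHermitian := hstar ht
  have hb : ‖c t - (R : ℂ) • 1‖ < R := by
    rw [← dist_eq_norm]
    exact (mem_closedBall.1 (hc t ht).2).trans_lt hr
  refine ⟨hH.posDef_of_norm_sub_smul_one_lt hb, ?_⟩
  rw [← ricciField_eq_neg_ncLaplacian_log x y hH hb]
  exact (hc t ht).1

/-- A Ricci flow solves the extended equation, in a ball determined by its initial value. -/
theorem IsRicciFlowOn.hasDerivWithinAt_ricciField [NeZero n] (hx : x.IsHermitian)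
    (hy : y.IsHermitian) {J : Set ℝ} (hJ : Convex ℝ J) {c : ℝ → Matrix (Fin n) (Fin n) ℂ}
    (hc : IsRicciFlowOn x y J c) {t₀ : ℝ} (ht₀ : IsLeast J t₀) :
    ∀ t ∈ J, HasDerivWithinAt c (ricciField x y (c t₀).trace.re (c t)) J t ∧
      c t ∈ closedBall (((c t₀).trace.re : ℂ) • 1)
        ((c t₀).trace.re - ((c t₀)⁻¹.trace.re)⁻¹) := by
  intro t ht
  have hb := norm_ricciFlow_sub_le hx hy hJ hc.posDef hc.hasDerivWithinAt ht₀.1 ht (ht₀.2 ht)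
  have hS : 0 < (c t₀)⁻¹.trace.re := (hc.posDef t₀ ht₀.1).inv.trace_re_pos
  refine ⟨?_, by rwa [mem_closedBall, dist_eq_norm]⟩
  rw [ricciField_eq_neg_ncLaplacian_log x y (hc.posDef t ht).isHermitian
    (hb.trans_lt (sub_lt_self _ (inv_pos.2 hS)))]
  exact hc.hasDerivWithinAt t ht

theorem exists_isRicciFlowOn_Ici [NeZero n] (hx : x.IsHermitian) (hy : y.IsHermitian) (t₀ : ℝ)
    {c₀ : Matrix (Fin n) (Fin n) ℂ} (hc₀ : c₀.PosDef) :
    ∃ c, IsRicciFlowOn x y (Ici t₀) c ∧ c t₀ = c₀ := by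
  set R : ℝ := c₀.trace.re
  set S : ℝ := c₀⁻¹.trace.re
  have hR : 0 < R := hc₀.trace_re_pos
  have hS : 0 < S⁻¹ := inv_pos.2 hc₀.inv.trace_re_pos
  have hb : ‖c₀ - (R : ℂ) • 1‖ ≤ R - S⁻¹ := hc₀.norm_sub_smul_one_le le_rfl le_rfl
  -- The working radius R - S⁻¹ / 2 lies strictly between the a priori radius R - S⁻¹ and the radius
  -- R of the disc of convergence.
  have hr' : 0 ≤ R - S⁻¹ / 2 := by linarith [(norm_nonneg _).trans hb]
  have hr'R : R - S⁻¹ / 2 < R := by linarith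
  obtain ⟨K, hK⟩ := exists_lipschitzOnWith_ricciField x y hR hr'R
  have hbd : ∀ a ∈ closedBall ((R : ℂ) • 1) (R - S⁻¹ / 2),
      ‖ricciField x y R a‖ ≤ (K * .mk (R - S⁻¹ / 2) hr' : ℝ≥0) :=
    fun a ha => norm_ricciField_le hR hr' hK ha
  obtain ⟨c, hc0, hc⟩ := exists_hasDerivWithinAt_Ici_of_apriori (r := R - S⁻¹) (by linarith) hK hbd
    (fun U hU φ hφ hm => hφ.ricciField x y hR hr'R hU hm) (t₀ := t₀) (c₀ := c₀)
    (by rw [mem_closedBall, dist_eq_norm]; linarith) (by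
      intro T c hT hc0 hc t ht
      have h1 := posDef_and_hasDerivWithinAt_of_ricciField hx hy hR hr'R ordConnected_Icc hc
        (left_mem_Icc.2 hT) (hc0 ▸ hc₀.isHermitian)
      have h2 := norm_ricciFlow_sub_le hx hy (convex_Icc t₀ T) (fun t ht => (h1 t ht).1)
        (fun t ht => (h1 t ht).2) (left_mem_Icc.2 hT) ht ht.1
      rw [hc0] at h2
      rwa [mem_closedBall, dist_eq_norm])
  have h1 := posDef_and_hasDerivWithinAt_of_ricciField hx hy hR hr'R ordConnected_Ici hc
    self_mem_Ici (hc0 ▸ hc₀.isHermitian)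
  refine ⟨c, ⟨fun t ht => (h1 t ht).1, ?_, fun t ht => (h1 t ht).2⟩, hc0⟩
  rw [contDiffOn_one_iff_derivWithin (uniqueDiffOn_Ici t₀)]
  refine ⟨fun t ht => (hc t ht).1.differentiableWithinAt, ?_⟩
  have hcont : ContinuousOn (fun t => ricciField x y R (c t)) (Ici t₀) :=
    hK.continuousOn.comp (fun t ht => (hc t ht).1.continuousWithinAt) fun t ht => (hc t ht).2
  exact hcont.congr fun t ht => (hc t ht).1.derivWithin (uniqueDiffOn_Ici t₀ t ht)

theorem IsRicciFlowOn.mono {J J' : Set ℝ} {c : ℝ → Matrix (Fin n) (Fin n) ℂ}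
    (hc : IsRicciFlowOn x y J c) (h : J' ⊆ J) : IsRicciFlowOn x y J' c :=
  ⟨fun t ht => hc.posDef t (h ht), hc.contDiffOn.mono h,
    fun t ht => (hc.hasDerivWithinAt t (h ht)).mono h⟩

/-- The common initial value confines both flows to the same ball, on which the extended field is
Lipschitz. -/
theorem IsRicciFlowOn.eqOn [NeZero n] (hx : x.IsHermitian) (hy : y.IsHermitian) {J : Set ℝ}
    (hJ : Convex ℝ J) {c d : ℝ → Matrix (Fin n) (Fin n) ℂ} (hc : IsRicciFlowOn x y J c)
    (hd : IsRicciFlowOn x y J d) {t₀ : ℝ} (ht₀ : IsLeast J t₀) (h : c t₀ = d t₀) :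
    EqOn c d J := by
  have h1 := hc.hasDerivWithinAt_ricciField hx hy hJ ht₀
  have h2 := hd.hasDerivWithinAt_ricciField hx hy hJ ht₀
  rw [← h] at h2
  have hp := hc.posDef t₀ ht₀.1
  obtain ⟨K, hK⟩ := exists_lipschitzOnWith_ricciField x y hp.trace_re_pos
    (sub_lt_self (c t₀).trace.re (inv_pos.2 hp.inv.trace_re_pos))
  exact eqOn_of_hasDerivWithinAt_ordConnected hK hJ.ordConnected (fun t ht => (h1 t ht).1)
    (fun t ht => (h1 t ht).2) (fun t ht => (h2 t ht).1) (fun t ht => (h2 t ht).2) ht₀.1 h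

theorem IsRicciFlowOn.entriesAnalyticOn [NeZero n] (hx : x.IsHermitian) (hy : y.IsHermitian)
    {J : Set ℝ} (hJ : Convex ℝ J) {c : ℝ → Matrix (Fin n) (Fin n) ℂ} (hc : IsRicciFlowOn x y J c)
    {t₀ : ℝ} (ht₀ : IsLeast J t₀) : EntriesAnalyticOn J c := by
  intro t₂ ht₂
  have hF := hc.hasDerivWithinAt_ricciField hx hy hJ ht₀
  have hR : 0 < (c t₀).trace.re := (hc.posDef t₀ ht₀.1).trace_re_pos
  have hS : 0 < ((c t₀)⁻¹.trace.re)⁻¹ := inv_pos.2 (hc.posDef t₀ ht₀.1).inv.trace_re_pos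
  set R : ℝ := (c t₀).trace.re
  set r : ℝ := R - ((c t₀)⁻¹.trace.re)⁻¹ with hr_def
  obtain ⟨r', hrr', hr'⟩ : ∃ r', r < r' ∧ r' < R := exists_between (by linarith)
  have h0r : 0 ≤ r' := (dist_nonneg.trans (mem_closedBall.1 (hF t₂ ht₂).2)).trans hrr'.le
  obtain ⟨K, hK⟩ := exists_lipschitzOnWith_ricciField x y hR hr'
  have hsub : closedBall (c t₂) (r' - r) ⊆ closedBall ((R : ℂ) • 1) r' := by
    apply closedBall_subset_closedBall'
    linarith [mem_closedBall.1 (hF t₂ ht₂).2]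
  obtain ⟨ρ, hρ, hKρ, hBρ⟩ :=
    exists_pos_mul_le_half_and_mul_le K (K * .mk r' h0r) (sub_pos.2 hrr')
  obtain ⟨φ, hφ0, hφ⟩ := exists_holomorphic_hasDerivAt (sub_pos.2 hrr').le hKρ hBρ hρ
    (hK.mono hsub) (fun a ha => norm_ricciField_le hR h0r hK (hsub ha))
    (fun φ h1 h2 => h1.ricciField x y hR hr' isOpen_ball (h2.mono_right hsub))
  have hball : ∀ t ∈ J ∩ Ioo (t₂ - ρ) (t₂ + ρ), ((t - t₂ : ℝ) : ℂ) ∈ ball (0 : ℂ) ρ := by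
    intro t ht
    rw [mem_ball_zero_iff, Complex.norm_real, Real.norm_eq_abs, abs_lt]
    constructor <;> linarith [ht.2.1, ht.2.2]
  -- The values of φ at real times are not known to be Hermitian, so uniqueness is applied to the
  -- extended equation, on both sides of `t₂`.
  have heq : EqOn c (fun t => φ ((t - t₂ : ℝ) : ℂ)) (J ∩ Ioo (t₂ - ρ) (t₂ + ρ)) := by
    refine eqOn_of_hasDerivWithinAt_ordConnected hK (hJ.ordConnected.inter ordConnected_Ioo)
      (fun t ht => (hF t ht.1).1.mono inter_subset_left)
      (fun t ht => closedBall_subset_closedBall hrr'.le (hF t ht.1).2) (fun t ht => ?_)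
      (fun t ht => hsub (hφ _ (hball t ht)).1) (a := t₂) ⟨ht₂, by linarith, by linarith⟩
      (by simp [hφ0])
    have hs : HasDerivAt (fun t : ℝ => ((t - t₂ : ℝ) : ℂ)) 1 t := by
      simpa using ((hasDerivAt_id t).sub_const t₂).ofReal_comp
    have := (hφ _ (hball t ht)).2.scomp t hs
    rw [one_smul] at this
    exact this.hasDerivWithinAt
  refine ⟨ρ, hρ, fun i j => ?_⟩
  have hent : DifferentiableOn ℂ (fun z => φ z i j) (ball 0 ρ) :=
    (LinearMap.toContinuousLinearMap
      (Matrix.entryLinearMap ℂ ℂ i j)).differentiable.comp_differentiableOn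
        fun z hz => (hφ z hz).2.differentiableAt.differentiableWithinAt
  refine ⟨fun k => (k.factorial : ℂ)⁻¹ * iteratedDeriv k (fun z => φ z i j) 0, fun t ht => ?_⟩
  have := Complex.hasSum_taylorSeries_on_ball hent (hball t ht)
  rw [heq ht]
  refine this.congr_fun fun k => ?_
  rw [sub_zero, smul_eq_mul, smul_eq_mul, Complex.ofReal_sub]
  ring

end Flow

end

theorem theorem3p1 (n m : ℕ) (u v x y : Matrix (Fin n) (Fin n) ℂ)
    (hT : IsFuzzyTorus n m u v x y) (t₀ : ℝ)
    (c₀ : Matrix (Fin n) (Fin n) ℂ) (hc₀ : c₀.PosDef) (J : Set ℝ)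
    (hJ : J = Set.Ici t₀ ∨ ∃ t₁, t₀ ≤ t₁ ∧ J = Set.Icc t₀ t₁) :
    (∃ c : ℝ → Matrix (Fin n) (Fin n) ℂ, (IsRicciFlowOn x y J c ∧ c t₀ = c₀) ∧
      ∀ c' : ℝ → Matrix (Fin n) (Fin n) ℂ,
        IsRicciFlowOn x y J c' ∧ c' t₀ = c₀ → Set.EqOn c' c J) ∧
    (∀ c : ℝ → Matrix (Fin n) (Fin n) ℂ,
      IsRicciFlowOn x y J c ∧ c t₀ = c₀ → EntriesAnalyticOn J c) := by
  have : NeZero n := ⟨(Nat.zero_lt_of_lt hT.lt).ne'⟩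
  obtain ⟨hconv, hleast⟩ : Convex ℝ J ∧ IsLeast J t₀ := by
    rcases hJ with rfl | ⟨t₁, h, rfl⟩
    · exact ⟨convex_Ici t₀, isLeast_Ici⟩
    · exact ⟨convex_Icc t₀ t₁, isLeast_Icc h⟩
  obtain ⟨c, hc, hc0⟩ := exists_isRicciFlowOn_Ici hT.x_herm hT.y_herm t₀ hc₀
  have hcJ : IsRicciFlowOn x y J c := hc.mono fun t ht => hleast.2 ht
  exact ⟨⟨c, ⟨hcJ, hc0⟩, fun c' hc' => hc'.1.eqOn hT.x_herm hT.y_herm hconv hcJ hleast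
    (hc'.2.trans hc0.symm)⟩,
    fun c hc => hc.1.entriesAnalyticOn hT.x_herm hT.y_herm hconv hleast⟩
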